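/- Let $A:\mathbb{R}^d\to\mathbb{R}^d$ be an expansive dilation, that is, a linear map with $A(\mathbb{Z}^d)\subseteq\mathbb{Z}^d$ all of whose (complex) eigenvalues have modulus strictly greater than $1$; let $A^*$ be its adjoint and $d_A=|\det A|$. Let $\mathcal{D}_A f(x)=d_A^{1/2}f(Ax)$ on $L^2(\mathbb{R}^d)$, and let $\widehat f$ denote the Fourier transform on $L^2(\mathbb{R}^d)$, normalized by $\widehat f(\xi)=\int f(x)e^{-2\pi i x\cdot\xi}\,dx$ for $f\in L^1\cap L^2$. Let $G\subseteq\mathbb{R}^d$ be a measurable set with $A^*G=G$, and let $$H^2_G=\{f\in L^2(\mathbb{R}^d):\widehat f=0\text{ a.e. outside }G\}.$$ Let $\Psi=\{\psi^\alpha\}_{\alpha\in I}$ be a finite or countably infinite family in $L^2(\mathbb{R}^d)$. Put $\psi^\alpha_{(j,k)}=d_A^{j/2}\,\psi^\alpha(A^j\cdot-k)$ for $\alpha\in I$, $j\in\mathbb{Z}$, $k\in\mathbb{Z}^d$, and let $W(\Psi)$ be the closed linear span of $\{\psi^\alpha_{(0,k)}:\alpha\in I,\ k\in\mathbb{Z}^d\}$.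 Suppose that $\Psi$ is a semiorthogonal tight frame multiwavelet of $H^2_G$, which means that all $\psi^\alpha_{(j,k)}$ belong to $H^2_G$, that $$\sum_{\alpha\in I}\sum_{j\in\mathbb{Z}}\sum_{k\in\mathbb{Z}^d}|\langle f,\psi^\alpha_{(j,k)}\rangle|^2=\|f\|^2\qquad\text{for all } f\in H^2_G,$$ and that the subspaces $\mathcal{D}_A^jW(\Psi)$, $j\in\mathbb{Z}$, are mutually orthogonal. Then for every $\alpha\in I$ the origin is a point of $A^*$-approximate continuity of $\widehat{\psi^\alpha}$ if we put $\widehat{\psi^\alpha}(0)=0$. That is, for every measurable function $g$ representing $\widehat{\psi^\alpha}$, with its value at the origin changed to $g(0)=0$, there is a measurable set $E\subseteq\mathbb{R}^d$ of positive measure such that $$\lim_{j\to\infty}\frac{|E\cap (A^*)^{-j}B_r|}{|(A^*)^{-j}B_r|}=1\quad\text{for all } r>0,\qquad\text{and}\qquad \lim_{\substack{\xi\to0\\ \xi\in E}}g(\xi)=0,$$ where $B_r$ is the open Euclidean ball of radius $r$ centred at the origin. -/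

import Mathlib

open MeasureTheory Filter Topology
open scoped FourierTransform

namespace WaveletOrigin

noncomputable section

/-- `ℝ^d` with its Euclidean norm, inner product and Lebesgue measure. -/
abbrev E (d : ℕ) := EuclideanSpace ℝ (Fin d)

/-- The complex Hilbert space `L²(ℝ^d)`. -/
abbrev L2 (d : ℕ) := Lp (α := E d) ℂ 2 volume

/-- The point of the lattice `ℤ^d ⊆ ℝ^d` with integer coordinates `k`. -/
def intVec {d : ℕ} (k : Fin d → ℤ) : E d := WithLp.toLp 2 (fun i => (k i : ℝ))

/-- An expansive dilation: a linear map `A` of `ℝ^d` with `A(ℤ^d) ⊆ ℤ^d`, all of whose complex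
eigenvalues (the complex roots of its characteristic polynomial) have modulus `> 1`. -/
structure IsExpansiveDilation {d : ℕ} (A : E d →ₗ[ℝ] E d) : Prop where
  map_lattice : ∀ k : Fin d → ℤ, ∃ m : Fin d → ℤ, A (intVec k) = intVec m
  one_lt_norm : ∀ z : ℂ, Polynomial.aeval z (LinearMap.charpoly A) = 0 → 1 < ‖z‖

/-- An expansive dilation is injective, since `0` is not an eigenvalue. -/
theorem IsExpansiveDilation.injective {d : ℕ} {A : E d →ₗ[ℝ] E d} (hA : IsExpansiveDilation A) :
    Function.Injective A := by
  rw [← LinearMap.ker_eq_bot]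
  by_contra hker
  have hdet : LinearMap.det A = 0 := by
    by_contra h
    exact hker (LinearMap.ker_eq_bot_of_injective
      ((LinearMap.equivOfDetNeZero A h).injective))
  have h0 : Polynomial.aeval (0 : ℂ) (LinearMap.charpoly A) = 0 := by
    have hc : (LinearMap.charpoly A).coeff 0 = 0 := by
      rw [LinearMap.det_eq_sign_charpoly_coeff] at hdet
      simpa using hdet
    rw [Polynomial.aeval_def, Polynomial.eval₂_at_zero, hc, map_zero]
  have := hA.one_lt_norm 0 h0
  simp at this
  linarith

/-- An expansive dilation, as an invertible linear map; so `hA.equiv ^ j` is `A^j` for every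
integer `j`. -/
def IsExpansiveDilation.equiv {d : ℕ} {A : E d →ₗ[ℝ] E d} (hA : IsExpansiveDilation A) :
    E d ≃ₗ[ℝ] E d :=
  LinearEquiv.ofInjectiveEndo A hA.injective

@[simp]
theorem IsExpansiveDilation.equiv_apply {d : ℕ} {A : E d →ₗ[ℝ] E d} (hA : IsExpansiveDilation A)
    (x : E d) : hA.equiv x = A x := rfl

theorem quasiMeasurePreserving_equiv {d : ℕ} (L : E d ≃ₗ[ℝ] E d) :
    Measure.QuasiMeasurePreserving L (volume : Measure (E d)) volume :=
  Measure.LinearMap.quasiMeasurePreserving volume (L : E d →ₗ[ℝ] E d) L.isUnit_det'.ne_zero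

theorem memLp_comp_equiv {d : ℕ} (L : E d ≃ₗ[ℝ] E d) (f : L2 d) :
    MemLp (fun x => f (L x)) 2 (volume : Measure (E d)) := by
  refine MemLp.comp_of_map (g := f) (f := L) ?_ (quasiMeasurePreserving_equiv L).aemeasurable
  have h := Measure.map_linearMap_addHaar_eq_smul_addHaar (volume : Measure (E d))
    (f := (L : E d →ₗ[ℝ] E d)) L.isUnit_det'.ne_zero
  rw [LinearEquiv.coe_coe] at h
  rw [h]
  exact (Lp.memLp f).smul_measure ENNReal.ofReal_ne_top

/-- The normalized dilation `f ↦ |det L|^{1/2} f(L ·)` on `L²(ℝ^d)`. For `L = A` it is the dilation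
operator `𝒟_A`, and for `L = A^j` it is `𝒟_A^j f = |det A|^{j/2} f(A^j ·)`, `j ∈ ℤ`. -/
def dilation {d : ℕ} (L : E d ≃ₗ[ℝ] E d) : L2 d →ₗ[ℂ] L2 d where
  toFun f := ((√|LinearMap.det (L : E d →ₗ[ℝ] E d)| : ℝ) : ℂ) • (memLp_comp_equiv L f).toLp _
  map_add' f g := by
    rw [← smul_add, ← MemLp.toLp_add]
    congr 1
    rw [MemLp.toLp_eq_toLp_iff]
    exact (quasiMeasurePreserving_equiv L).ae_eq_comp (Lp.coeFn_add f g)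
  map_smul' c f := by
    rw [RingHom.id_apply, smul_comm c]
    congr 1
    rw [← MemLp.toLp_const_smul]
    rw [MemLp.toLp_eq_toLp_iff]
    exact (quasiMeasurePreserving_equiv L).ae_eq_comp (Lp.coeFn_smul c f)

/-- The translation `f ↦ f(· - k)` of `L²(ℝ^d)`, for `k ∈ ℤ^d`. -/
def translation {d : ℕ} (k : Fin d → ℤ) (f : L2 d) : L2 d :=
  Lp.compMeasurePreserving (fun x => x - intVec k) (measurePreserving_sub_right volume (intVec k)) f

/-- The element `ψ_{(j,k)} = |det A|^{j/2} ψ(A^j · - k)` of the affine system generated by `ψ`. -/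
def affineElem {d : ℕ} (A : E d ≃ₗ[ℝ] E d) (ψ : L2 d) (j : ℤ) (k : Fin d → ℤ) : L2 d :=
  dilation (A ^ j) (translation k ψ)

theorem affineElem_coeFn {d : ℕ} (A : E d ≃ₗ[ℝ] E d) (ψ : L2 d) (j : ℤ) (k : Fin d → ℤ) :
    affineElem A ψ j k =ᵐ[volume] fun x =>
      ((|LinearMap.det (A : E d →ₗ[ℝ] E d)| ^ ((j : ℝ) / 2) : ℝ) : ℂ)
        * ψ ((A ^ j) x - intVec k) := by
  have hdet : √|LinearMap.det ((A ^ j : E d ≃ₗ[ℝ] E d) : E d →ₗ[ℝ] E d)|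
      = |LinearMap.det (A : E d →ₗ[ℝ] E d)| ^ ((j : ℝ) / 2) := by
    rw [← LinearEquiv.coe_det, map_zpow, Units.val_zpow_eq_zpow_val, LinearEquiv.coe_det,
      abs_zpow, Real.sqrt_eq_rpow, ← Real.rpow_intCast, ← Real.rpow_mul (abs_nonneg _)]
    congr 1
    ring
  have h1 := Lp.coeFn_smul ((√|LinearMap.det ((A ^ j : E d ≃ₗ[ℝ] E d) : E d →ₗ[ℝ] E d)| : ℝ) : ℂ)
    ((memLp_comp_equiv (A ^ j) (translation k ψ)).toLp _)
  have h2 := (memLp_comp_equiv (A ^ j) (translation k ψ)).coeFn_toLp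
  have h3 := (quasiMeasurePreserving_equiv (A ^ j)).ae_eq_comp
    (Lp.coeFn_compMeasurePreserving ψ (measurePreserving_sub_right volume (intVec k)))
  filter_upwards [h1, h2, h3] with x h1 h2 h3
  refine h1.trans ?_
  rw [Pi.smul_apply, h2, hdet, smul_eq_mul]
  exact congrArg _ h3

/-- `W(Ψ)`: the closed linear span in `L²(ℝ^d)` of the integer translates of the generators. -/
def shiftSpan {d : ℕ} {ι : Type*} (Ψ : ι → L2 d) : Submodule ℂ (L2 d) :=
  (Submodule.span ℂ
    (Set.range fun p : ι × (Fin d → ℤ) => translation p.2 (Ψ p.1))).topologicalClosure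

/-- `H²_G`: the functions of `L²(ℝ^d)` whose Fourier transform vanishes almost everywhere
outside `G`. -/
def HardySpace {d : ℕ} (G : Set (E d)) : Set (L2 d) :=
  {f | ∀ᵐ ξ ∂(volume : Measure (E d)), ξ ∉ G → (𝓕 f : L2 d) ξ = 0}

/-- `Ψ` is a tight frame multiwavelet of `H²_G`: the affine system generated by `Ψ` lies in `H²_G`
and is a tight frame (with constant one) of it. -/
structure IsTightFrameMultiwavelet {d : ℕ} {ι : Type*} (A : E d ≃ₗ[ℝ] E d) (G : Set (E d))
    (Ψ : ι → L2 d) : Prop where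
  mem : ∀ α j k, affineElem A (Ψ α) j k ∈ HardySpace G
  hasSum : ∀ f ∈ HardySpace G,
    HasSum (fun p : ι × ℤ × (Fin d → ℤ) => ‖inner ℂ f (affineElem A (Ψ p.1) p.2.1 p.2.2)‖ ^ 2)
      (‖f‖ ^ 2)

/-- `Ψ` is a semiorthogonal tight frame multiwavelet of `H²_G`: moreover the subspaces
`𝒟_A^j W(Ψ)`, `j ∈ ℤ`, are mutually orthogonal. -/
structure IsSemiorthogonalTightFrameMultiwavelet {d : ℕ} {ι : Type*} (A : E d ≃ₗ[ℝ] E d)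
    (G : Set (E d)) (Ψ : ι → L2 d) : Prop extends IsTightFrameMultiwavelet A G Ψ where
  orthogonal : ∀ i j : ℤ, i ≠ j →
    (shiftSpan Ψ).map (dilation (A ^ i)) ⟂ (shiftSpan Ψ).map (dilation (A ^ j))

/-- The origin is a point of `B`-density for `S`. The preimage of the ball `B_r` under `B^j` is
the set `B^{-j} B_r`. -/
def IsDensityPointAtOrigin {d : ℕ} (B : E d →ₗ[ℝ] E d) (S : Set (E d)) : Prop :=
  ∀ r : ℝ, 0 < r →
    Tendsto (fun j : ℕ =>
      volume.real (S ∩ (B ^ j : E d →ₗ[ℝ] E d) ⁻¹' Metric.ball 0 r)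
        / volume.real ((B ^ j : E d →ₗ[ℝ] E d) ⁻¹' Metric.ball 0 r))
      atTop (𝓝 1)

/-- The origin is a point of `B`-approximate continuity of the function `f`. -/
def IsApproxContinuousAtOrigin {d : ℕ} (B : E d →ₗ[ℝ] E d) (f : E d → ℂ) : Prop :=
  ∃ S : Set (E d), MeasurableSet S ∧ 0 < volume S ∧ IsDensityPointAtOrigin B S ∧
    Tendsto f (𝓝[S] 0) (𝓝 (f 0))

end

end WaveletOrigin

namespace WaveletOrigin

/-! Fix `r` and test the frame identity on the `f` whose Fourier transform is the indicator of `B_r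
∩ G`. By Plancherel and the change of variables `ξ = (A^*)^j η`, the coefficient `⟨f, ψ_{(j,k)}⟩`
has modulus `d_A^{j/2}` times that of the `k`-th Fourier coefficient of `ψ̂` restricted to
`(A^*)^{-j} B_r`; the set `G` drops out because it is invariant and carries `ψ̂`. For large `j` that
ellipsoid lies in the unit cube, and Parseval gives `∑_k |⟨f, ψ_{(j,k)}⟩|² = d_A^j ∫_{(A^*)^{-j}
B_r} |ψ̂|²`. These are terms of a convergent series, so they tend to zero: the averages of `|ψ̂|²`
over the shrinking ellipsoids vanish in the limit
(`IsTightFrameMultiwavelet.tendsto_setIntegral_sq_fourier`).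

Chebyshev's inequality then shows that each set `{|ψ̂| ≥ 1/(n+1)}` has density zero at the origin.
Cutting the `n`-th of these sets down to a small enough ball and removing the union leaves a set of
density one along which `ψ̂ → 0` (`exists_set_tendsto_zero`). -/

/-! ### Expansive maps: the ellipsoids shrink to the origin. -/

/-- In a complex Banach algebra, the powers of an element whose spectrum lies in the open unit
disc tend to zero in norm. -/
theorem tendsto_norm_pow_of_spectrum_lt_one {𝔸 : Type*} [NormedRing 𝔸] [NormedAlgebra ℂ 𝔸]
    [CompleteSpace 𝔸] [Nontrivial 𝔸] (a : 𝔸) (ha : ∀ z ∈ spectrum ℂ a, ‖z‖ < 1) :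
    Tendsto (fun n : ℕ => ‖a ^ n‖) atTop (𝓝 0) := by
  have h1 : spectralRadius ℂ a < (1 : NNReal) :=
    spectrum.spectralRadius_lt_of_forall_lt a fun z hz => by
      rw [← NNReal.coe_lt_coe]; simpa using ha z hz
  -- Gelfand's formula gives `‖a ^ n‖ < s ^ n` eventually, for any `s` strictly between the spectral
  -- radius and `1`.
  obtain ⟨s, hs1, hs2⟩ := ENNReal.lt_iff_exists_nnreal_btwn.1 h1
  have hev := (spectrum.pow_nnnorm_pow_one_div_tendsto_nhds_spectralRadius a).eventually_lt_const
    hs1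
  have hs : (s : ℝ) < 1 := by exact_mod_cast hs2
  refine squeeze_zero' (Eventually.of_forall fun _ => norm_nonneg _) ?_
    (tendsto_pow_atTop_nhds_zero_of_lt_one s.coe_nonneg hs)
  filter_upwards [hev, eventually_gt_atTop 0] with n hn hn0
  have hn' : (n : ℝ) ≠ 0 := by positivity
  have h2 := ENNReal.rpow_lt_rpow hn (show (0 : ℝ) < n by positivity)
  rw [← ENNReal.rpow_mul, one_div, inv_mul_cancel₀ hn', ENNReal.rpow_one,
    ENNReal.rpow_natCast] at h2
  have h3 : ‖a ^ n‖₊ < s ^ n := by exact_mod_cast h2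
  exact_mod_cast h3.le

/-- The adjoint of a real endomorphism has the same characteristic polynomial. -/
theorem charpoly_adjoint {d : ℕ} (A : E d →ₗ[ℝ] E d) :
    (LinearMap.adjoint A).charpoly = A.charpoly := by
  let b := EuclideanSpace.basisFun (Fin d) ℝ
  rw [← LinearMap.charpoly_toMatrix _ b.toBasis, LinearMap.toMatrix_adjoint,
    ← LinearMap.charpoly_toMatrix A b.toBasis, Matrix.conjTranspose_eq_transpose_of_trivial,
    Matrix.charpoly_transpose]

/-- The adjoint of a real endomorphism has the same determinant. -/
theorem det_adjoint {d : ℕ} (A : E d →ₗ[ℝ] E d) :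
    LinearMap.det (LinearMap.adjoint A) = LinearMap.det A := by
  rw [LinearMap.det_eq_sign_charpoly_coeff, LinearMap.det_eq_sign_charpoly_coeff A,
    charpoly_adjoint]

attribute [local instance] Matrix.linftyOpNormedRing Matrix.linftyOpNormedAlgebra in
/-- If all complex eigenvalues of `L` have modulus greater than one, the sets `L^{-j} B_r` shrink
to the origin. -/
theorem eventually_preimage_ball_subset {d : ℕ} (L : E d →ₗ[ℝ] E d)
    (hL : ∀ z : ℂ, Polynomial.aeval z (LinearMap.charpoly L) = 0 → 1 < ‖z‖) (r δ : ℝ)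
    (hδ : 0 < δ) :
    ∀ᶠ j : ℕ in atTop, ∀ x : E d, ‖(L ^ j) x‖ < r → ‖x‖ < δ := by
  rcases Nat.eq_zero_or_pos d with rfl | hd
  · refine Eventually.of_forall fun j x _ => ?_
    rw [Subsingleton.elim x 0, norm_zero]; exact hδ
  have : Nonempty (Fin d) := ⟨⟨0, hd⟩⟩
  let b := (EuclideanSpace.basisFun (Fin d) ℝ).toBasis
  -- Complexifying makes the roots of the characteristic polynomial into the spectrum of `M`; the
  -- spectrum of the inverse then lies in the open unit disc.
  let M : Matrix (Fin d) (Fin d) ℂ := (LinearMap.toMatrix b b L).map (algebraMap ℝ ℂ)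
  have hMc : M.charpoly = (LinearMap.charpoly L).map (algebraMap ℝ ℂ) := by
    rw [← LinearMap.charpoly_toMatrix L b, Matrix.charpoly_map]
  have hspec : ∀ z ∈ spectrum ℂ M, 1 < ‖z‖ := fun z hz => by
    rw [Matrix.mem_spectrum_iff_isRoot_charpoly, hMc, Polynomial.IsRoot,
      Polynomial.eval_map_algebraMap] at hz
    exact hL z hz
  have hu : IsUnit M := by
    by_contra h
    have := hspec 0 ((spectrum.zero_mem_iff ℂ).2 h)
    simp at this
    linarith
  obtain ⟨u, hu⟩ := hu
  have hinv : ∀ z ∈ spectrum ℂ ((u⁻¹ : (Matrix (Fin d) (Fin d) ℂ)ˣ) : Matrix (Fin d) (Fin d) ℂ),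
      ‖z‖ < 1 := fun z hz => by
    rw [← spectrum.map_inv, Set.mem_inv, hu] at hz
    have h := hspec _ hz
    rw [norm_inv] at h
    by_contra hcon
    exact absurd h (not_lt.2 (inv_le_one_of_one_le₀ (not_lt.1 hcon)))
  have hlim := tendsto_norm_pow_of_spectrum_lt_one _ hinv
  -- This embedding intertwines `L` with `M`. The sup norm on the target matches the operator norm
  -- chosen on matrices and costs a factor `√d` against the Euclidean norm.
  let v : E d → (Fin d → ℂ) := fun x i => (x i : ℂ)
  have hv : ∀ x, M.mulVec (v x) = v (L x) := fun x => by
    ext i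
    have h := congrFun (LinearMap.toMatrix_mulVec_repr b b L x) i
    simp only [v, ← show b.repr (L x) i = (L x) i from rfl, ← h, M, Matrix.mulVec, dotProduct,
      Matrix.map_apply]
    push_cast
    rfl
  have hvj : ∀ (j : ℕ) x, (M ^ j).mulVec (v x) = v ((L ^ j) x) := fun j => by
    induction j with
    | zero => simp
    | succ j ih =>
      intro x
      rw [pow_succ, ← Matrix.mulVec_mulVec, hv, ih, pow_succ, Module.End.mul_apply]
  have hvnorm : ∀ x, ‖v x‖ ≤ ‖x‖ := fun x =>
    (pi_norm_le_iff_of_nonneg (norm_nonneg _)).2 fun i => by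
      simpa [v] using PiLp.norm_apply_le x i
  have hnormv : ∀ x, ‖x‖ ≤ √d * ‖v x‖ := fun x => by
    rw [EuclideanSpace.norm_eq]
    refine Real.sqrt_le_iff.2 ⟨by positivity, ?_⟩
    rw [mul_pow, Real.sq_sqrt (by positivity)]
    calc ∑ i, ‖x i‖ ^ 2 ≤ ∑ _i : Fin d, ‖v x‖ ^ 2 := by
          refine Finset.sum_le_sum fun i _ => ?_
          have := norm_le_pi_norm (v x) i
          simp only [v, Complex.norm_real] at this
          gcongr
      _ = d * ‖v x‖ ^ 2 := by simp
  have hsmall : Tendsto (fun j : ℕ => √d *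
      (‖((u⁻¹ : (Matrix (Fin d) (Fin d) ℂ)ˣ) : Matrix (Fin d) (Fin d) ℂ) ^ j‖ * r)) atTop (𝓝 0) := by
    simpa using (hlim.mul_const r).const_mul (√d)
  filter_upwards [hsmall.eventually_lt_const hδ] with j hj x hx
  refine lt_of_le_of_lt ((hnormv x).trans ?_) hj
  have h1 : ((u⁻¹ : (Matrix (Fin d) (Fin d) ℂ)ˣ) : Matrix (Fin d) (Fin d) ℂ) ^ j * M ^ j = 1 := by
    rw [← hu, ← Units.val_pow_eq_pow_val, ← Units.val_pow_eq_pow_val, ← Units.val_mul, inv_pow,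
      inv_mul_cancel, Units.val_one]
  have h2 : v x = (((u⁻¹ : (Matrix (Fin d) (Fin d) ℂ)ˣ) : Matrix (Fin d) (Fin d) ℂ) ^ j).mulVec
      (v ((L ^ j) x)) := by
    rw [← hvj, Matrix.mulVec_mulVec, h1, Matrix.one_mulVec]
  refine mul_le_mul_of_nonneg_left ?_ (Real.sqrt_nonneg _)
  rw [h2]
  refine (Matrix.linfty_opNorm_mulVec _ _).trans ?_
  exact mul_le_mul_of_nonneg_left ((hvnorm _).trans hx.le) (norm_nonneg _)

/-! ### Gluing the superlevel sets into one exceptional set. -/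

/-- If each superlevel set of `‖g‖` has vanishing weighted measure along the sets `P j r`, then
there is a set along which `g` tends to zero at the origin and whose complement has vanishing
weighted measure. -/
theorem exists_set_tendsto_zero {d : ℕ} (hd : 0 < d) (g : E d → ℂ) (hg : Measurable g)
    (w : ℕ → ℝ) (hw : ∀ j, 0 < w j) (P : ℕ → ℝ → Set (E d))
    (hfin : ∀ j r, volume (P j r) ≠ ⊤) (hmono : ∀ j r s, r ≤ s → P j r ⊆ P j s)
    (h : ∀ (n : ℕ) (r : ℝ), 0 < r → Tendsto
      (fun j => w j * volume.real ({x | 1 / ((n : ℝ) + 1) ≤ ‖g x‖} ∩ P j r)) atTop (𝓝 0)) :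
    ∃ S : Set (E d), MeasurableSet S ∧
      (∀ r : ℝ, 0 < r → Tendsto (fun j => w j * volume.real (Sᶜ ∩ P j r)) atTop (𝓝 0)) ∧
      ∀ ε : ℝ, 0 < ε → ∃ δ : ℝ, 0 < δ ∧ ∀ x ∈ S, ‖x‖ < δ → ‖g x‖ < ε := by
  set bad : ℕ → Set (E d) := fun n => {x | 1 / ((n : ℝ) + 1) ≤ ‖g x‖} with hbad
  have hbadm : ∀ n, MeasurableSet (bad n) := fun n => measurableSet_le measurable_const hg.norm
  -- The radius `n + 1` grows with `n`, so that any fixed `r` is covered by all but finitely many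
  -- `n`.
  have hJ : ∀ n : ℕ, ∃ J : ℕ, ∀ j ≥ J, w j * volume.real (bad n ∩ P j (n + 1)) ≤ (1 / 2) ^ n :=
    fun n => by
      have := (h n (n + 1) (by positivity)).eventually_le_const
        (show (0 : ℝ) < (1 / 2) ^ n by positivity)
      exact eventually_atTop.1 this
  choose J hJ using hJ
  have hball : Tendsto (fun δ : ℝ => volume.real (Metric.ball (0 : E d) δ)) (𝓝[>] 0) (𝓝 0) := by
    have : Nonempty (Fin d) := ⟨⟨0, hd⟩⟩
    have h1 : Tendsto (fun δ : ℝ => δ ^ d * volume.real (Metric.ball (0 : E d) 1)) (𝓝[>] 0)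
        (𝓝 0) := by
      have : Continuous (fun δ : ℝ => δ ^ d * volume.real (Metric.ball (0 : E d) 1)) := by fun_prop
      have h2 := (this.tendsto 0).mono_left (nhdsWithin_le_nhds (s := Set.Ioi 0))
      simpa [hd.ne'] using h2
    refine h1.congr' ?_
    filter_upwards [self_mem_nhdsWithin] with δ hδ
    have hδ' : (0 : ℝ) ≤ δ := le_of_lt hδ
    rw [Measure.real, Measure.real, Measure.addHaar_ball _ _ hδ', ENNReal.toReal_mul,
      ENNReal.toReal_ofReal (by positivity), finrank_euclideanSpace_fin]
  -- The finitely many scales `j < J n` are handled by the smallness of the ball alone.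
  have hδ : ∀ n : ℕ, ∃ δ : ℝ, 0 < δ ∧
      ∀ j < J n, w j * volume.real (Metric.ball (0 : E d) δ) ≤ (1 / 2) ^ n := fun n => by
    have h1 : ∀ j ∈ Finset.range (J n), ∀ᶠ δ in 𝓝[>] (0 : ℝ),
        w j * volume.real (Metric.ball (0 : E d) δ) ≤ (1 / 2) ^ n := fun j _ => by
      have h2 := hball.const_mul (w j)
      rw [mul_zero] at h2
      exact h2.eventually_le_const (by positivity)
    have h3 := (Finset.eventually_all _).2 h1
    obtain ⟨δ, hδ1, hδ2⟩ := (h3.and self_mem_nhdsWithin).exists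
    exact ⟨δ, hδ2, fun j hj => hδ1 j (Finset.mem_range.2 hj)⟩
  choose δ hδ0 hδ using hδ
  let T : Set (E d) := ⋃ n, bad n ∩ Metric.ball 0 (δ n)
  have hT : MeasurableSet T := MeasurableSet.iUnion fun n => (hbadm n).inter measurableSet_ball
  refine ⟨Tᶜ, hT.compl, fun r hr => ?_, fun ε hε => ?_⟩
  · rw [compl_compl]
    let a : ℕ → ℕ → ℝ := fun j n => w j * volume.real ((bad n ∩ Metric.ball 0 (δ n)) ∩ P j r)
    have ha0 : ∀ j n, 0 ≤ a j n := fun j n => mul_nonneg (hw j).le measureReal_nonneg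
    have hale : ∀ j n, a j n ≤ w j * volume.real (bad n ∩ P j r) := fun j n =>
      mul_le_mul_of_nonneg_left (measureReal_mono
        (Set.inter_subset_inter_left _ Set.inter_subset_left)
        (measure_ne_top_of_subset Set.inter_subset_right (hfin j r))) (hw j).le
    have hlim : ∀ n, Tendsto (fun j => a j n) atTop (𝓝 0) := fun n =>
      squeeze_zero (fun j => ha0 j n) (fun j => hale j n) (h n r hr)
    -- A bound uniform in `j` and summable in `n`, needed for dominated convergence of the series.
    -- The finitely many `n` with `n < N` are bounded only because `a · n` converges.
    have hdom : ∀ (j n : ℕ), r ≤ n + 1 → a j n ≤ (1 / 2) ^ n := fun j n hrn => by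
      rcases lt_or_ge j (J n) with hj | hj
      · refine le_trans (mul_le_mul_of_nonneg_left (measureReal_mono ?_ ?_) (hw j).le) (hδ n j hj)
        · exact Set.inter_subset_left.trans Set.inter_subset_right
        · exact measure_ball_lt_top.ne
      · refine le_trans (mul_le_mul_of_nonneg_left (measureReal_mono ?_ ?_) (hw j).le) (hJ n j hj)
        · exact Set.inter_subset_inter Set.inter_subset_left (hmono _ _ _ hrn)
        · exact measure_ne_top_of_subset Set.inter_subset_right (hfin _ _)
    have hbdd : ∀ n, ∃ C : ℝ, ∀ j, a j n ≤ C := fun n => by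
      obtain ⟨C, hC⟩ := (hlim n).bddAbove_range
      exact ⟨C, fun j => hC ⟨j, rfl⟩⟩
    choose C hC using hbdd
    obtain ⟨N, hN⟩ := exists_nat_ge r
    let bd : ℕ → ℝ := fun n => (if n < N then C n else 0) + (1 / 2) ^ n
    have hbd : Summable bd := by
      refine Summable.add ?_ summable_geometric_two
      refine summable_of_ne_finset_zero (s := Finset.range N) fun n hn => ?_
      rw [if_neg (by simpa using hn)]
    have hab : ∀ j n, a j n ≤ bd n := fun j n => by
      by_cases hn : n < N
      · simp only [bd, if_pos hn]
        have : (0 : ℝ) ≤ (1 / 2) ^ n := by positivity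
        linarith [hC n j]
      · simp only [bd, if_neg hn, zero_add]
        refine hdom j n (hN.trans ?_)
        have : (N : ℝ) ≤ n := by exact_mod_cast not_lt.1 hn
        linarith
    have hsum : Tendsto (fun j => ∑' n, a j n) atTop (𝓝 0) := by
      have := tendsto_tsum_of_dominated_convergence (f := a) (g := fun _ => (0 : ℝ)) hbd hlim
        (Eventually.of_forall fun j n => by
          rw [Real.norm_of_nonneg (ha0 j n)]; exact hab j n)
      simpa using this
    have hsm : ∀ j, Summable (a j) := fun j => hbd.of_nonneg_of_le (ha0 j) (hab j)
    refine squeeze_zero (fun j => mul_nonneg (hw j).le measureReal_nonneg) (fun j => ?_) hsum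
    have hsm' : Summable fun n => volume.real ((bad n ∩ Metric.ball 0 (δ n)) ∩ P j r) :=
      (summable_mul_left_iff (hw j).ne').1 (hsm j)
    simp only [a]
    rw [tsum_mul_left]
    refine mul_le_mul_of_nonneg_left ?_ (hw j).le
    refine ENNReal.toReal_le_of_le_ofReal (tsum_nonneg fun _ => measureReal_nonneg) ?_
    rw [ENNReal.ofReal_tsum_of_nonneg (fun _ => measureReal_nonneg) hsm', Set.iUnion_inter]
    refine (measure_iUnion_le _).trans (ENNReal.tsum_le_tsum fun n => ?_)
    rw [Measure.real, ENNReal.ofReal_toReal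
      (measure_ne_top_of_subset Set.inter_subset_right (hfin j r))]
  · obtain ⟨n, hn⟩ := exists_nat_one_div_lt hε
    refine ⟨δ n, hδ0 n, fun x hx hxδ => ?_⟩
    by_contra hcon
    refine hx (Set.mem_iUnion.2 ⟨n, hn.le.trans (not_lt.1 hcon), ?_⟩)
    simpa using hxδ

/-! ### Fourier series on the centred unit cube. -/

/-- The character `η ↦ e^{-2πi k·η}` of `ℝ^d`. -/
noncomputable def latticeChar {d : ℕ} (k : Fin d → ℤ) (η : E d) : ℂ :=
  (Real.fourierChar (-(inner ℝ (intVec k) η)) : Circle)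

theorem norm_latticeChar {d : ℕ} (k : Fin d → ℤ) (η : E d) : ‖latticeChar k η‖ = 1 :=
  Circle.norm_coe _

theorem continuous_latticeChar {d : ℕ} (k : Fin d → ℤ) : Continuous (latticeChar k) := by
  unfold latticeChar
  exact continuous_subtype_val.comp (Real.continuous_fourierChar.comp (by fun_prop))

/-- The unit cube centred at the origin. -/
def centredCube (d : ℕ) : Set (E d) := {x | ∀ i, x i ∈ Set.Ioc (-1 / 2 : ℝ) (-1 / 2 + 1)}

/-- The section of `ℝ^d → ℝ^d / ℤ^d` with values in the centred unit cube. -/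
noncomputable def torusSection (d : ℕ) (t : UnitAddTorus (Fin d)) : E d :=
  WithLp.toLp 2 (UnitAddTorus.measurableEquivPiIoc (fun _ => (-1 / 2 : ℝ)) t).1

theorem measurableSet_pi_Ioc (d : ℕ) :
    MeasurableSet {x : Fin d → ℝ | ∀ i, x i ∈ Set.Ioc (-1 / 2 : ℝ) (-1 / 2 + 1)} :=
  MeasurableSet.univ_pi' fun _ => measurableSet_Ioc

theorem measurableEmbedding_torusSection (d : ℕ) : MeasurableEmbedding (torusSection d) :=
  (MeasurableEquiv.toLp 2 (Fin d → ℝ)).measurableEmbedding.comp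
    ((MeasurableEmbedding.subtype_coe (measurableSet_pi_Ioc d)).comp
      (UnitAddTorus.measurableEquivPiIoc fun _ => (-1 / 2 : ℝ)).measurableEmbedding)

section Torus

attribute [local instance] instMeasureSpaceUnitAddCircle

/-- This turns integrals over the torus into integrals over the cube, carrying Parseval's identity
to `ℝ^d`. -/
theorem measurePreserving_torusSection (d : ℕ) :
    MeasurePreserving (torusSection d) volume (volume.restrict (centredCube d)) := by
  have h1 := UnitAddTorus.measurePreserving_equivPiIoc (d := Fin d) (a := fun _ => (-1 / 2 : ℝ))
  have h2 := measurePreserving_subtype_coe (μa := (volume : Measure (Fin d → ℝ)))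
    (measurableSet_pi_Ioc d)
  have h3 := (PiLp.volume_preserving_toLp (Fin d)).restrict_preimage_emb
    (MeasurableEquiv.toLp 2 (Fin d → ℝ)).measurableEmbedding (centredCube d)
  exact h3.comp (h2.comp h1)

/-- Fourier coefficients on the torus pair with the character of index `-k`, which agrees with the
phase that translation by `k` produces under the Fourier transform. -/
theorem mFourier_neg_eq_latticeChar {d : ℕ} (k : Fin d → ℤ) (t : UnitAddTorus (Fin d)) :
    UnitAddTorus.mFourier (-k) t = latticeChar k (torusSection d t) := by
  have ht : t = fun i => ((torusSection d t i : ℝ) : UnitAddCircle) := by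
    ext i
    exact (AddCircle.coe_equivIoc (p := (1 : ℝ)) (a := -1 / 2) (y := t i)).symm
  have h1 : UnitAddTorus.mFourier (-k) t
      = ∏ i, Complex.exp (2 * Real.pi * Complex.I * (-k i) * (torusSection d t i)) := by
    conv_lhs => rw [ht]
    simp only [UnitAddTorus.mFourier, ContinuousMap.coe_mk, fourier_coe_apply, Pi.neg_apply]
    refine Finset.prod_congr rfl fun i _ => ?_
    congr 1
    push_cast
    ring
  rw [h1, latticeChar, Real.fourierChar_apply, ← Complex.exp_sum]
  congr 1
  rw [PiLp.inner_apply]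
  push_cast
  rw [← Finset.sum_neg_distrib, Finset.mul_sum, Finset.sum_mul]
  refine Finset.sum_congr rfl fun i _ => ?_
  simp [intVec]
  ring

/-- Parseval's identity for the Fourier coefficients of a square integrable function on `ℝ^d`
supported in the centred unit cube. -/
theorem hasSum_sq_integral_latticeChar {d : ℕ} (h : E d → ℂ) (hh : MemLp h 2 volume)
    (hsupp : ∀ x, x ∉ centredCube d → h x = 0) :
    HasSum (fun k : Fin d → ℤ => ‖∫ x, latticeChar k x * h x‖ ^ 2) (∫ x, ‖h x‖ ^ 2) := by
  have hρ := measurePreserving_torusSection d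
  have hemb := measurableEmbedding_torusSection d
  have hF : MemLp (h ∘ torusSection d) 2 volume :=
    (hh.restrict (centredCube d)).comp_measurePreserving hρ
  have hS := UnitAddTorus.hasSum_sq_mFourierCoeff (hF.toLp _)
  have hset : ∀ {V : Type} [NormedAddCommGroup V] [NormedSpace ℝ V] (u : E d → V),
      (∀ x, x ∉ centredCube d → u x = 0) → ∫ t, u (torusSection d t) = ∫ x, u x :=
    fun u hu => by
      rw [hρ.integral_comp hemb, setIntegral_eq_integral_of_forall_compl_eq_zero hu]
  have h1 : ∫ t, ‖hF.toLp _ t‖ ^ 2 = ∫ x, ‖h x‖ ^ 2 := by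
    rw [← hset (fun x => ‖h x‖ ^ 2) fun x hx => by simp [hsupp x hx]]
    refine integral_congr_ae ?_
    filter_upwards [hF.coeFn_toLp] with t ht
    rw [ht, Function.comp]
  have h2 : ∀ k, UnitAddTorus.mFourierCoeff (hF.toLp _) k = ∫ x, latticeChar k x * h x :=
    fun k => by
      rw [← hset (fun x => latticeChar k x * h x) fun x hx => by simp [hsupp x hx]]
      refine integral_congr_ae ?_
      filter_upwards [hF.coeFn_toLp] with t ht
      rw [ht, mFourier_neg_eq_latticeChar, smul_eq_mul, Function.comp]
  simpa only [h1, h2] using hS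

end Torus

theorem mem_centredCube_of_norm_lt {d : ℕ} {x : E d} (hx : ‖x‖ < 1 / 2) : x ∈ centredCube d :=
  fun i => by
    have h := (PiLp.norm_apply_le x i).trans_lt hx
    rw [Real.norm_eq_abs, abs_lt] at h
    exact ⟨by linarith, by linarith⟩

/-! ### Dilations and translations under the Fourier transform. -/

theorem integral_comp_linearEquiv {d : ℕ} {V : Type*} [NormedAddCommGroup V] [NormedSpace ℝ V]
    (L : E d ≃ₗ[ℝ] E d) (f : E d → V) :
    ∫ x, f (L x) = |LinearMap.det (L : E d →ₗ[ℝ] E d)|⁻¹ • ∫ x, f x := by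
  have hemb : MeasurableEmbedding L :=
    L.toContinuousLinearEquiv.toHomeomorph.measurableEmbedding
  have h := Measure.map_linearMap_addHaar_eq_smul_addHaar (volume : Measure (E d))
    (f := (L : E d →ₗ[ℝ] E d)) L.isUnit_det'.ne_zero
  rw [LinearEquiv.coe_coe] at h
  rw [← hemb.integral_map, h, integral_smul_measure, ENNReal.toReal_ofReal (abs_nonneg _), abs_inv]

/-- The isometry property serves the density argument below, where `dilation L` must be continuous.
-/
theorem norm_dilation {d : ℕ} (L : E d ≃ₗ[ℝ] E d) (f : L2 d) : ‖dilation L f‖ = ‖f‖ := by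
  have hdet : 0 < |LinearMap.det (L : E d →ₗ[ℝ] E d)| := abs_pos.2 L.isUnit_det'.ne_zero
  have key : ‖dilation L f‖ ^ 2 = ‖f‖ ^ 2 := by
    have hn : ∀ g : L2 d, ‖g‖ ^ 2 = ∫ x, ‖g x‖ ^ 2 := fun g => by
      have h := inner_self_eq_norm_sq (𝕜 := ℂ) g
      rw [← h, L2.inner_def, ← integral_re (L2.integrable_inner g g)]
      simp only [inner_self_eq_norm_sq]
    rw [hn f, hn]
    have h1 : ∫ x, ‖dilation L f x‖ ^ 2
        = ∫ x, |LinearMap.det (L : E d →ₗ[ℝ] E d)| * ‖f (L x)‖ ^ 2 := by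
      refine integral_congr_ae ?_
      filter_upwards [Lp.coeFn_smul ((√|LinearMap.det (L : E d →ₗ[ℝ] E d)| : ℝ) : ℂ)
        ((memLp_comp_equiv L f).toLp _), (memLp_comp_equiv L f).coeFn_toLp] with x h1 h2
      change ‖(((√|LinearMap.det (L : E d →ₗ[ℝ] E d)| : ℝ) : ℂ) •
        (memLp_comp_equiv L f).toLp _ : L2 d) x‖ ^ 2 = _
      rw [h1, Pi.smul_apply, h2, norm_smul, mul_pow, Complex.norm_real, Real.norm_eq_abs, sq_abs,
        Real.sq_sqrt (abs_nonneg _)]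
    rw [h1, integral_const_mul, integral_comp_linearEquiv L (fun x => ‖f x‖ ^ 2), smul_eq_mul,
      ← mul_assoc, mul_inv_cancel₀ hdet.ne', one_mul]
  exact (pow_left_inj₀ (norm_nonneg _) (norm_nonneg _) two_ne_zero).1 key

theorem continuous_dilation {d : ℕ} (L : E d ≃ₗ[ℝ] E d) : Continuous (dilation L) :=
  (AddMonoidHomClass.isometry_of_norm (dilation L) (norm_dilation L)).continuous

theorem continuous_translation {d : ℕ} (k : Fin d → ℤ) :
    Continuous (translation k : L2 d → L2 d) :=
  (Lp.isometry_compMeasurePreserving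
    (measurePreserving_sub_right volume (intVec k))).continuous

theorem dilation_coeFn {d : ℕ} (L : E d ≃ₗ[ℝ] E d) (f : L2 d) :
    dilation L f =ᵐ[volume]
      fun x => ((√|LinearMap.det (L : E d →ₗ[ℝ] E d)| : ℝ) : ℂ) * f (L x) := by
  filter_upwards [Lp.coeFn_smul ((√|LinearMap.det (L : E d →ₗ[ℝ] E d)| : ℝ) : ℂ)
    ((memLp_comp_equiv L f).toLp _), (memLp_comp_equiv L f).coeFn_toLp] with x h1 h2
  refine h1.trans ?_
  rw [Pi.smul_apply, h2, smul_eq_mul]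

theorem dilation_translation_coeFn {d : ℕ} (L : E d ≃ₗ[ℝ] E d) (k : Fin d → ℤ) (f : L2 d) :
    dilation L (translation k f) =ᵐ[volume]
      fun x => ((√|LinearMap.det (L : E d →ₗ[ℝ] E d)| : ℝ) : ℂ) * f (L x - intVec k) := by
  filter_upwards [dilation_coeFn L (translation k f),
    (quasiMeasurePreserving_equiv L).ae_eq_comp
    (Lp.coeFn_compMeasurePreserving f (measurePreserving_sub_right volume (intVec k)))] with x h1 h2
  rw [h1]
  exact congrArg _ h2

/-- The Fourier transform of a dilated and translated function. -/
theorem fourier_comp_sub {d : ℕ} (L M : E d ≃ₗ[ℝ] E d)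
    (hM : ∀ x y, inner ℝ (L x) y = inner ℝ x (M y)) (k : Fin d → ℤ) (f : E d → ℂ) (c : ℂ)
    (η : E d) :
    𝓕 (fun x => c * f (L x - intVec k)) (M η)
      = |LinearMap.det (L : E d →ₗ[ℝ] E d)|⁻¹ * (c * (latticeChar k η * 𝓕 f η)) := by
  rw [Real.fourier_eq, Real.fourier_eq]
  -- Evaluating at `M η` makes the phase a function of `L x`, so one change of variables removes `L`
  -- altogether.
  simp_rw [← hM]
  rw [integral_comp_linearEquiv L
    (fun y => (𝐞 (-(inner ℝ y η)) : Circle) • (c * f (y - intVec k))),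
    ← integral_add_right_eq_self _ (intVec k), Complex.real_smul]
  push_cast
  congr 1
  rw [← integral_const_mul, ← integral_const_mul]
  refine integral_congr_ae (Eventually.of_forall fun y => ?_)
  simp only [add_sub_cancel_right, inner_add_left, neg_add, AddChar.map_add_eq_mul, latticeChar,
    Circle.smul_def, Circle.coe_mul, smul_eq_mul]
  ring

/-- The inner product of `u` with the Fourier transform of a dilated and translated function. -/
theorem inner_fourier_dilation_translation {d : ℕ} (L M : E d ≃ₗ[ℝ] E d)
    (hM : ∀ x y, inner ℝ (L x) y = inner ℝ x (M y)) (k : Fin d → ℤ) (u ψ : L2 d) :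
    inner ℂ u (𝓕 (dilation L (translation k ψ)) : L2 d)
      = ((√|LinearMap.det (L : E d →ₗ[ℝ] E d)| : ℝ) : ℂ)
        * ∫ η, latticeChar k η * ((𝓕 ψ : L2 d) η * (starRingEnd ℂ) (u (M η))) := by
  set c : ℂ := ((√|LinearMap.det (L : E d →ₗ[ℝ] E d)| : ℝ) : ℂ) with hc
  have hdetM : |LinearMap.det (M : E d →ₗ[ℝ] E d)| = |LinearMap.det (L : E d →ₗ[ℝ] E d)| := by
    have : (M : E d →ₗ[ℝ] E d) = LinearMap.adjoint (L : E d →ₗ[ℝ] E d) :=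
      (LinearMap.eq_adjoint_iff _ _).2 fun x y => by
        rw [real_inner_comm, LinearEquiv.coe_coe, ← hM, real_inner_comm, LinearEquiv.coe_coe]
    rw [this, det_adjoint]
  have hdet : ((|LinearMap.det (L : E d →ₗ[ℝ] E d)| : ℝ) : ℂ) ≠ 0 := by
    exact_mod_cast abs_ne_zero.2 L.isUnit_det'.ne_zero
  -- The integral on the right becomes an inner product with a fixed `L²` function. Both sides are
  -- then continuous in `ψ`, and Schwartz functions suffice.
  have hw : MemLp (fun η => (starRingEnd ℂ) (latticeChar k η) * u (M η)) 2 volume := by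
    have h0 := memLp_comp_equiv M u
    refine h0.congr_norm (AEStronglyMeasurable.mul ?_ h0.1) ?_
    · exact (Complex.continuous_conj.comp (continuous_latticeChar k)).aestronglyMeasurable
    · exact Eventually.of_forall fun η => by simp [norm_latticeChar]
  have hwi : ∀ v : L2 d, inner ℂ (hw.toLp _) v
      = ∫ η, latticeChar k η * (v η * (starRingEnd ℂ) (u (M η))) := fun v => by
    rw [L2.inner_def]
    refine integral_congr_ae ?_
    filter_upwards [hw.coeFn_toLp] with η hη
    rw [hη, RCLike.inner_apply, map_mul, Complex.conj_conj]
    ring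
  rw [← hwi]
  refine DenseRange.induction_on (p := fun ψ : L2 d =>
    inner ℂ u (𝓕 (dilation L (translation k ψ)) : L2 d) = c * inner ℂ (hw.toLp _) (𝓕 ψ : L2 d))
    (SchwartzMap.denseRange_toLpCLM (F := ℂ) (E := E d) (μ := volume) (p := 2)
      ENNReal.ofNat_ne_top) ψ ?_ ?_
  · have hF : Continuous fun ψ : L2 d => (𝓕 ψ : L2 d) :=
      (Lp.fourierTransformₗᵢ (E d) ℂ).continuous
    refine isClosed_eq ?_ ?_
    · exact continuous_const.inner
        (hF.comp ((continuous_dilation L).comp (continuous_translation k)))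
    · exact continuous_const.mul (continuous_const.inner hF)
  · intro φ
    rw [hwi, SchwartzMap.toLpCLM_apply, SchwartzMap.toLp_fourier_eq]
    let χ : SchwartzMap (E d) ℂ := c • SchwartzMap.compCLMOfContinuousLinearEquiv ℂ
      L.toContinuousLinearEquiv (SchwartzMap.compSubConstCLM ℂ (intVec k) φ)
    have hχ : ∀ x, χ x = c * φ (L x - intVec k) := fun x => rfl
    have hχL : dilation L (translation k (φ.toLp 2)) = χ.toLp 2 := by
      refine Lp.ext ?_
      have hq : Measure.QuasiMeasurePreserving (fun x => L x - intVec k)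
          (volume : Measure (E d)) volume :=
        (measurePreserving_sub_right volume (intVec k)).quasiMeasurePreserving.comp
          (quasiMeasurePreserving_equiv L)
      filter_upwards [dilation_translation_coeFn L k (φ.toLp 2), χ.coeFn_toLp 2 volume,
        hq.ae_eq_comp (φ.coeFn_toLp 2 volume)] with x h1 h2 h3
      rw [h1, h2, hχ]
      exact congrArg _ h3
    rw [hχL, SchwartzMap.toLp_fourier_eq, L2.inner_def]
    have h1 : ∫ ξ, inner ℂ (u ξ) ((𝓕 χ).toLp 2 volume ξ)
        = ∫ ξ, inner ℂ (u ξ) (𝓕 χ ξ) := by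
      refine integral_congr_ae ?_
      filter_upwards [(𝓕 χ).coeFn_toLp 2 volume] with ξ hξ
      rw [hξ]
    -- Substitution `ξ = M η`; its Jacobian cancels the inverse determinant coming from
    -- `fourier_comp_sub`.
    have h2 := integral_comp_linearEquiv M (fun ξ => inner ℂ (u ξ) (𝓕 χ ξ))
    rw [hdetM, Complex.real_smul] at h2
    push_cast at h2
    have h3 : ∫ ξ, inner ℂ (u ξ) (𝓕 χ ξ)
        = ((|LinearMap.det (L : E d →ₗ[ℝ] E d)| : ℝ) : ℂ) * ∫ η, inner ℂ (u (M η)) (𝓕 χ (M η)) := by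
      rw [h2, ← mul_assoc, mul_inv_cancel₀ hdet, one_mul]
    rw [h1, h3, ← integral_const_mul, ← integral_const_mul]
    refine integral_congr_ae ?_
    filter_upwards [(𝓕 φ).coeFn_toLp 2 volume] with η hη
    have h4 : 𝓕 χ (M η) = ((|LinearMap.det (L : E d →ₗ[ℝ] E d)| : ℝ) : ℂ)⁻¹
        * (c * (latticeChar k η * 𝓕 φ η)) := by
      have := fourier_comp_sub L M hM k φ c η
      push_cast at this
      rw [SchwartzMap.fourier_coe, SchwartzMap.fourier_coe, ← this]
      rfl
    rw [hη, h4, RCLike.inner_apply]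
    field_simp

/-! ### Powers of the dilation and of its adjoint. -/

theorem affineElem_zero_zero {d : ℕ} (A : E d ≃ₗ[ℝ] E d) (ψ : L2 d) : affineElem A ψ 0 0 = ψ := by
  refine Lp.ext ?_
  filter_upwards [affineElem_coeFn A ψ 0 0] with x hx
  rw [hx]
  have h0 : (intVec (0 : Fin d → ℤ)) = 0 := by ext i; simp [intVec]
  simp [h0]

/-- The adjoint of an expansive dilation, as an invertible linear map. -/
noncomputable def IsExpansiveDilation.adjointEquiv {d : ℕ} {A : E d →ₗ[ℝ] E d}
    (hA : IsExpansiveDilation A) : E d ≃ₗ[ℝ] E d :=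
  LinearMap.equivOfDetNeZero (LinearMap.adjoint A) (by
    rw [det_adjoint]; exact hA.equiv.isUnit_det'.ne_zero)

theorem IsExpansiveDilation.adjointEquiv_pow_apply {d : ℕ} {A : E d →ₗ[ℝ] E d}
    (hA : IsExpansiveDilation A) (j : ℕ) (x : E d) :
    (hA.adjointEquiv ^ j) x = (LinearMap.adjoint A ^ j) x := by
  induction j generalizing x with
  | zero => simp
  | succ j ih =>
    rw [pow_succ, pow_succ, LinearEquiv.mul_apply, Module.End.mul_apply, ih]
    rfl

theorem IsExpansiveDilation.inner_equiv_pow {d : ℕ} {A : E d →ₗ[ℝ] E d}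
    (hA : IsExpansiveDilation A) (j : ℕ) (x y : E d) :
    inner ℝ ((hA.equiv ^ (j : ℤ)) x) y = inner ℝ x ((hA.adjointEquiv ^ j) y) := by
  rw [zpow_natCast]
  induction j generalizing x y with
  | zero => simp
  | succ j ih =>
    rw [pow_succ, pow_succ', LinearEquiv.mul_apply, LinearEquiv.mul_apply, ih, hA.equiv_apply]
    exact (LinearMap.adjoint_inner_right A _ _).symm

theorem IsExpansiveDilation.abs_det_equiv_pow {d : ℕ} {A : E d →ₗ[ℝ] E d}
    (hA : IsExpansiveDilation A) (j : ℕ) :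
    |LinearMap.det ((hA.equiv ^ (j : ℤ) : E d ≃ₗ[ℝ] E d) : E d →ₗ[ℝ] E d)|
      = |LinearMap.det A| ^ j := by
  rw [← LinearEquiv.coe_det, map_zpow, Units.val_zpow_eq_zpow_val, LinearEquiv.coe_det,
    abs_zpow, zpow_natCast]
  rfl

theorem IsExpansiveDilation.abs_det_pos {d : ℕ} {A : E d →ₗ[ℝ] E d}
    (hA : IsExpansiveDilation A) : 0 < |LinearMap.det A| :=
  abs_pos.2 hA.equiv.isUnit_det'.ne_zero

theorem measurableSet_preimage_ball {d : ℕ} (B : E d →ₗ[ℝ] E d) (r : ℝ) :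
    MeasurableSet (B ⁻¹' Metric.ball 0 r) :=
  measurableSet_ball.preimage B.continuous_of_finiteDimensional.measurable

theorem IsExpansiveDilation.volume_preimage_ball {d : ℕ} {A : E d →ₗ[ℝ] E d}
    (hA : IsExpansiveDilation A) (j : ℕ) (r : ℝ) :
    volume ((LinearMap.adjoint A ^ j : E d →ₗ[ℝ] E d) ⁻¹' Metric.ball 0 r)
      = ENNReal.ofReal ((|LinearMap.det A| ^ j)⁻¹) * volume (Metric.ball (0 : E d) r) := by
  have hdet : LinearMap.det (LinearMap.adjoint A ^ j) = LinearMap.det A ^ j := by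
    rw [map_pow, det_adjoint]
  rw [Measure.addHaar_preimage_linearMap, hdet, abs_inv, abs_pow]
  rw [hdet]
  exact pow_ne_zero _ (abs_pos.1 hA.abs_det_pos)

theorem mem_iff_pow_apply_mem {d : ℕ} {B : E d →ₗ[ℝ] E d} (hB : Function.Injective B)
    {G : Set (E d)} (hG : B '' G = G) (j : ℕ) (x : E d) : (B ^ j) x ∈ G ↔ x ∈ G := by
  induction j generalizing x with
  | zero => simp
  | succ j ih =>
    rw [pow_succ, Module.End.mul_apply, ih]
    conv_lhs => rw [← hG]
    exact hB.mem_set_image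

/-! ### The frame identity forces the averages to vanish. -/

/-- The averages of `|ψ̂|²` over the sets `(A^*)^{-j} B_r` tend to zero for every generator `ψ` of
a tight frame multiwavelet. -/
theorem IsTightFrameMultiwavelet.tendsto_setIntegral_sq_fourier {d : ℕ} {A : E d →ₗ[ℝ] E d}
    (hA : IsExpansiveDilation A) {G : Set (E d)} (hG : MeasurableSet G)
    (hGinv : LinearMap.adjoint A '' G = G) {ι : Type*} {Ψ : ι → L2 d}
    (hΨ : IsTightFrameMultiwavelet hA.equiv G Ψ) (α : ι) (r : ℝ) :
    Tendsto (fun j : ℕ => |LinearMap.det A| ^ j *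
      ∫ x in (LinearMap.adjoint A ^ j : E d →ₗ[ℝ] E d) ⁻¹' Metric.ball 0 r,
        ‖(𝓕 (Ψ α) : L2 d) x‖ ^ 2) atTop (𝓝 0) := by
  set B := LinearMap.adjoint A with hB
  set φ : L2 d := 𝓕 (Ψ α) with hφ
  have hinj : Function.Injective B := hA.adjointEquiv.injective
  have hφG : ∀ᵐ x ∂(volume : Measure (E d)), x ∉ G → φ x = 0 := by
    have := hΨ.mem α 0 0
    rwa [affineElem_zero_zero] at this
  -- Intersecting the ball with `G` is what places the test function in `H²_G`.
  have hK : MeasurableSet (Metric.ball (0 : E d) r ∩ G) := measurableSet_ball.inter hG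
  have hKfin : volume (Metric.ball (0 : E d) r ∩ G) ≠ ⊤ :=
    measure_ne_top_of_subset Set.inter_subset_left measure_ball_lt_top.ne
  set u : L2 d := indicatorConstLp 2 hK hKfin (1 : ℂ) with hu
  have hucoe : u =ᵐ[volume] (Metric.ball (0 : E d) r ∩ G).indicator fun _ => (1 : ℂ) :=
    indicatorConstLp_coeFn
  set f : L2 d := (Lp.fourierTransformₗᵢ (E d) ℂ).symm u with hf
  have hfu : (𝓕 f : L2 d) = u := (Lp.fourierTransformₗᵢ (E d) ℂ).apply_symm_apply u
  have hfG : f ∈ HardySpace G := by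
    change ∀ᵐ ξ ∂(volume : Measure (E d)), ξ ∉ G → (𝓕 f : L2 d) ξ = 0
    rw [hfu]
    filter_upwards [hucoe] with x hx hxG
    rw [hx, Set.indicator_of_notMem fun h => hxG h.2]
  have hinner : ∀ (j : ℕ) (k : Fin d → ℤ),
      ‖inner ℂ f (affineElem hA.equiv (Ψ α) j k)‖ ^ 2 = |LinearMap.det A| ^ j *
        ‖∫ x, latticeChar k x * ((B ^ j : E d →ₗ[ℝ] E d) ⁻¹' Metric.ball 0 r).indicator φ x‖ ^ 2 :=
    fun j k => by
      rw [← Lp.inner_fourier_eq, hfu, affineElem, inner_fourier_dilation_translation _ _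
        (hA.inner_equiv_pow j), hA.abs_det_equiv_pow, norm_mul, mul_pow, Complex.norm_real,
        Real.norm_eq_abs, sq_abs, Real.sq_sqrt (by positivity)]
      congr 3
      refine integral_congr_ae ?_
      filter_upwards [hφG, (quasiMeasurePreserving_equiv (hA.adjointEquiv ^ j)).ae_eq_comp hucoe]
        with x h1 h2
      have h2' : u ((hA.adjointEquiv ^ j) x)
          = (Metric.ball (0 : E d) r ∩ G).indicator (fun _ => (1 : ℂ)) ((B ^ j) x) := by
        rw [← hA.adjointEquiv_pow_apply]; exact h2
      rw [h2']
      congr 1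
      -- The set `G` disappears here: on `G` the point `(B ^ j) x` stays in `G`, and off `G` the
      -- function `φ` vanishes.
      by_cases hx : x ∈ G
      · have hx' := (mem_iff_pow_apply_mem hinj hGinv j x).2 hx
        by_cases hb : x ∈ (B ^ j : E d →ₗ[ℝ] E d) ⁻¹' Metric.ball 0 r
        · rw [Set.indicator_of_mem (show (B ^ j) x ∈ Metric.ball 0 r ∩ G from ⟨hb, hx'⟩), Set.indicator_of_mem hb,
            map_one, mul_one]
        · rw [Set.indicator_of_notMem (fun h : (B ^ j) x ∈ _ => hb h.1), Set.indicator_of_notMem hb, map_zero,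
            mul_zero]
      · rw [← hφ, h1 hx, zero_mul, Set.indicator_apply_eq_zero.2 fun _ => h1 hx]
  -- One generator and the scales `j ≥ 0` form a subfamily of the convergent frame sum; summing over
  -- `k` first leaves a convergent series in `j`.
  have hsum : Summable fun p : ℕ × (Fin d → ℤ) =>
      ‖inner ℂ f (affineElem hA.equiv (Ψ α) p.1 p.2)‖ ^ 2 :=
    (hΨ.hasSum f hfG).summable.comp_injective
      (i := fun p : ℕ × (Fin d → ℤ) => (α, (p.1 : ℤ), p.2)) fun p q hpq => by
        simp only [Prod.mk.injEq, Nat.cast_inj, true_and] at hpq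
        exact Prod.ext hpq.1 hpq.2
  refine hsum.prod.tendsto_atTop_zero.congr' ?_
  -- Radius `1 / 2` puts the ellipsoid inside the centred cube, as Parseval's identity requires.
  filter_upwards [eventually_preimage_ball_subset B (fun z hz => hA.one_lt_norm z (by
    rwa [hB, charpoly_adjoint] at hz)) r (1 / 2) (by norm_num)] with j hj
  have hm := measurableSet_preimage_ball (B ^ j) r
  have hP := hasSum_sq_integral_latticeChar _ ((Lp.memLp φ).indicator hm) fun x hx =>
    Set.indicator_of_notMem (fun hxb => hx (mem_centredCube_of_norm_lt (hj x (by simpa using hxb)))) _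
  simp only [hinner]
  rw [(hP.mul_left _).tsum_eq, ← integral_indicator hm]
  congr 2
  ext x
  by_cases hx : x ∈ (B ^ j : E d →ₗ[ℝ] E d) ⁻¹' Metric.ball 0 r
  · rw [Set.indicator_of_mem hx, Set.indicator_of_mem hx]
  · rw [Set.indicator_of_notMem hx, Set.indicator_of_notMem hx, norm_zero, zero_pow two_ne_zero]

/-! ### From vanishing averages to approximate continuity. -/

/-- If the averages of `|g|²` over the sets `(A^*)^{-j} B_r` tend to zero for all `r`, then the
origin is a point of `A^*`-approximate continuity of `g`, redefined as zero at the origin. -/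
theorem IsExpansiveDilation.isApproxContinuousAtOrigin_update {d : ℕ} {A : E d →ₗ[ℝ] E d}
    (hA : IsExpansiveDilation A) (g : E d → ℂ) (hg : Measurable g) (hg2 : MemLp g 2 volume)
    (h : ∀ r : ℝ, Tendsto (fun j : ℕ => |LinearMap.det A| ^ j *
      ∫ x in (LinearMap.adjoint A ^ j : E d →ₗ[ℝ] E d) ⁻¹' Metric.ball 0 r, ‖g x‖ ^ 2)
      atTop (𝓝 0)) :
    IsApproxContinuousAtOrigin (LinearMap.adjoint A) (Function.update g 0 0) := by
  have hV : ∀ r : ℝ, 0 < r → 0 < volume.real (Metric.ball (0 : E d) r) := fun r hr =>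
    ENNReal.toReal_pos (Metric.measure_ball_pos _ _ hr).ne' measure_ball_lt_top.ne
  set P : ℕ → ℝ → Set (E d) := fun j r =>
    (LinearMap.adjoint A ^ j : E d →ₗ[ℝ] E d) ⁻¹' Metric.ball 0 r with hPdef
  have hPfin : ∀ j r, volume (P j r) ≠ ⊤ := fun j r => by
    rw [hPdef]
    simp only [hA.volume_preimage_ball]
    exact ENNReal.mul_ne_top ENNReal.ofReal_ne_top measure_ball_lt_top.ne
  have hPvol : ∀ j r, volume.real (P j r)
      = (|LinearMap.det A| ^ j)⁻¹ * volume.real (Metric.ball (0 : E d) r) := fun j r => by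
    rw [hPdef]
    simp only [Measure.real, hA.volume_preimage_ball]
    rw [ENNReal.toReal_mul, ENNReal.toReal_ofReal (by positivity)]
  have hDpos : ∀ j : ℕ, 0 < |LinearMap.det A| ^ j := fun j => pow_pos hA.abs_det_pos j
  have hPpos : ∀ j r, 0 < r → 0 < volume.real (P j r) := fun j r hr => by
    rw [hPvol]; exact mul_pos (inv_pos.2 (hDpos j)) (hV r hr)
  -- In dimension zero small balls keep their measure, so `exists_set_tendsto_zero` does not apply;
  -- there the space is the origin alone.
  rcases Nat.eq_zero_or_pos d with rfl | hd
  · refine ⟨Set.univ, MeasurableSet.univ, ?_, fun r hr => ?_, ?_⟩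
    · exact (isOpen_univ.measure_pos _ Set.univ_nonempty)
    · simp only [Set.univ_inter]
      refine tendsto_const_nhds.congr fun j => ?_
      exact (div_self (hPpos j r hr).ne').symm
    · have : Function.update g 0 0 = fun _ => Function.update g 0 0 0 := by
        ext x; rw [Subsingleton.elim x 0]
      rw [this]
      exact tendsto_const_nhds
  have hbad : ∀ (n : ℕ) (r : ℝ), 0 < r → Tendsto (fun j => |LinearMap.det A| ^ j *
      volume.real ({x | 1 / ((n : ℝ) + 1) ≤ ‖g x‖} ∩ P j r)) atTop (𝓝 0) := fun n r _ => by
    have hε : (0 : ℝ) < 1 / ((n : ℝ) + 1) := by positivity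
    have h1 := (h r).const_mul (((1 / ((n : ℝ) + 1)) ^ 2)⁻¹)
    rw [mul_zero] at h1
    refine squeeze_zero (fun j => mul_nonneg (hDpos j).le measureReal_nonneg) (fun j => ?_) h1
    have hm : MeasurableSet {x | 1 / ((n : ℝ) + 1) ≤ ‖g x‖} :=
      measurableSet_le measurable_const hg.norm
    -- Chebyshev's inequality for `‖g‖²` on `P j r`.
    have h2 := mul_meas_ge_le_integral_of_nonneg (μ := volume.restrict (P j r))
      (f := fun x => ‖g x‖ ^ 2) (Eventually.of_forall fun x => sq_nonneg _)
      ((hg2.integrable_norm_pow two_ne_zero).restrict) ((1 / ((n : ℝ) + 1)) ^ 2)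
    have h3 : {x | (1 / ((n : ℝ) + 1)) ^ 2 ≤ ‖g x‖ ^ 2} = {x | 1 / ((n : ℝ) + 1) ≤ ‖g x‖} := by
      ext x
      exact pow_le_pow_iff_left₀ hε.le (norm_nonneg _) two_ne_zero
    rw [h3, measureReal_restrict_apply hm] at h2
    rw [mul_left_comm]
    refine mul_le_mul_of_nonneg_left ?_ (hDpos j).le
    rwa [← div_eq_inv_mul, le_div_iff₀' (by positivity)]
  obtain ⟨S, hS, hSd, hSg⟩ := exists_set_tendsto_zero hd g hg (fun j => |LinearMap.det A| ^ j) hDpos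
    P hPfin (fun j r s hrs => Set.preimage_mono (Metric.ball_subset_ball hrs)) hbad
  have hdens : IsDensityPointAtOrigin (LinearMap.adjoint A) S := fun r hr => by
    have h1 := ((hSd r hr).div_const (volume.real (Metric.ball (0 : E d) r))).const_sub 1
    rw [zero_div, sub_zero] at h1
    refine h1.congr fun j => ?_
    change _ = volume.real (S ∩ P j r) / volume.real (P j r)
    have h2 := measureReal_inter_add_sdiff (μ := volume) (s := P j r) hS (h := hPfin j r)
    rw [Set.sdiff_eq, Set.inter_comm, Set.inter_comm _ Sᶜ] at h2
    have h3 : volume.real (S ∩ P j r) = volume.real (P j r) - volume.real (Sᶜ ∩ P j r) := by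
      linarith
    rw [h3, sub_div, div_self (hPpos j r hr).ne', hPvol]
    have := hDpos j
    have := hV r hr
    field_simp
  refine ⟨S, hS, ?_, hdens, ?_⟩
  -- Positive measure follows from density: a null set would have density `0`, not `1`.
  · rw [pos_iff_ne_zero]
    intro h0
    have h1 := hdens 1 one_pos
    have h2 : ∀ X : Set (E d), volume.real (S ∩ X) = 0 := fun X => by
      rw [Measure.real, measure_mono_null Set.inter_subset_left h0, ENNReal.toReal_zero]
    simp only [h2, zero_div] at h1
    exact zero_ne_one (tendsto_nhds_unique tendsto_const_nhds h1)
  · rw [Function.update_self, Metric.tendsto_nhdsWithin_nhds]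
    intro ε hε
    obtain ⟨δ, hδ, hSδ⟩ := hSg ε hε
    refine ⟨δ, hδ, fun x hx hxδ => ?_⟩
    rw [dist_zero_right] at hxδ ⊢
    by_cases hx0 : x = 0
    · rw [hx0, Function.update_self, norm_zero]; exact hε
    · rw [Function.update_of_ne hx0]; exact hSδ x hx hxδ

end WaveletOrigin

theorem mainTheorem5 {d : ℕ} (A : WaveletOrigin.E d →ₗ[ℝ] WaveletOrigin.E d)
    (hA : WaveletOrigin.IsExpansiveDilation A)
    (G : Set (WaveletOrigin.E d)) (hG : MeasurableSet G)
    (hGinv : LinearMap.adjoint A '' G = G)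
    {ι : Type*} [Countable ι] (Ψ : ι → WaveletOrigin.L2 d)
    (hΨ : WaveletOrigin.IsSemiorthogonalTightFrameMultiwavelet hA.equiv G Ψ)
    (α : ι) (g : WaveletOrigin.E d → ℂ) (hg : Measurable g)
    (hgΨ : g =ᵐ[volume] (𝓕 (Ψ α) : WaveletOrigin.L2 d)) :
    WaveletOrigin.IsApproxContinuousAtOrigin (LinearMap.adjoint A) (Function.update g 0 0) := by
  refine hA.isApproxContinuousAtOrigin_update g hg ((memLp_congr_ae hgΨ).2 (Lp.memLp _))
    fun r => ?_
  have h := hΨ.toIsTightFrameMultiwavelet.tendsto_setIntegral_sq_fourier hA hG hGinv α r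
  refine h.congr fun j => ?_
  congr 1
  refine integral_congr_ae (ae_restrict_of_ae ?_)
  filter_upwards [hgΨ] with x hx
  rw [hx]
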